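/- Let $(A,\mu)$ be a Lie algebroid over a smooth manifold $M$, with bracket $[\cdot,\cdot]$ on $\Gamma(A)$ and anchor $\rho$, and let $\omega_1,\omega_2,\omega_3\in\Gamma(\wedge^2A^*)$ be non-degenerate $2$-forms with inverse bivectors $\pi_1,\pi_2,\pi_3$, i.e. $\pi_i^\sharp=(\omega_i^\flat)^{-1}$, where $\langle\omega^\flat(X),Y\rangle=\omega(X,Y)$. Indices are taken in $\mathbb Z/3\mathbb Z$. Put $N_i:=\pi_{i-1}^\sharp\circ\omega_{i+1}^\flat:A\to A$. Assume that $(\omega_1,\omega_2,\omega_3)$ is a hypersymplectic or para-hypersymplectic structure with torsion on $(A,\mu)$, i.e. there are signs $\varepsilon_i=\pm1$ with $\varepsilon_1\varepsilon_2\varepsilon_3=-1$ (all equal to $-1$ in the hypersymplectic case, not all equal to $-1$ in the para-hypersymplectic case) such that $$N_i^2=\varepsilon_i\,\mathrm{id}_A\quad(i=1,2,3),\qquad \varepsilon_2N_1\mathrm d\omega_1=\varepsilon_3N_2\mathrm d\omega_2=\varepsilon_1N_3\mathrm d\omega_3,$$ where $\mathrm d$ is the differential of $(A,\mu)$ and $(N_i\mathrm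 d\omega_i)(X,Y,Z):=\mathrm d\omega_i(N_iX,N_iY,N_iZ)$. Then $$C_\mu(\omega_i,N_j)=0\qquad\text{for all } i,j\in\{1,2,3\},\ i\neq j.$$ Here the concomitant of a $2$-form $\omega$ and an endomorphism $N$ of $A$ is $C_\mu(\omega,N)=\{N,\{\omega,\mu\}\}+\{\omega,\{N,\mu\}\}$, with $\{\cdot,\cdot\}$ the big bracket. Explicitly, consider pairs $\Theta$ formed by a bracket $[\cdot,\cdot]_\Theta$ on $\Gamma(A\oplus A^*)$ and an anchor $\rho_\Theta$; the pair of $\mu$ is the Dorfman bracket $[X+\alpha,Y+\beta]=[X,Y]+\mathcal L_X\beta-i_Y\mathrm d\alpha$ with anchor $X+\alpha\mapsto\rho(X)$. For an endomorphism $J$ of $A\oplus A^*$, $\Theta_J=\{J,\Theta\}$ is the pair with bracket $[e,e']_J=[Je,e']_\Theta+[e,Je']_\Theta-J[e,e']_\Theta$ and anchor $\rho_\Theta\circ J$. Identify $\omega$ with the endomorphism $X+\alpha\mapsto 0+\omega^\flat(X)$ and $N$ with $N\oplus(-N^*)$. Then $C_\mu(\omega,N)=(\mu_\omega)_N+(\mu_N)_\omega$,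 and $C_\mu(\omega,N)=0$ means that both its bracket and its anchor vanish. -/

import Mathlib

open scoped Manifold ContDiff Bundle
open Bundle

set_option linter.unusedSectionVars false

noncomputable section HypersymplecticTorsion

namespace HST

section Basic

variable {E : Type*} [NormedAddCommGroup E] [NormedSpace ℝ E]
  {H : Type*} [TopologicalSpace H] (I : ModelWithCorners ℝ E H)

/-- The algebra `C^∞(M)` of smooth real functions on the manifold `M`. -/
abbrev Fun (M : Type*) [TopologicalSpace M] [ChartedSpace H M] : Type _ :=
  C^∞⟮I, M; 𝓘(ℝ, ℝ), ℝ⟯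

variable {M : Type*} [TopologicalSpace M] [ChartedSpace H M]
  (F : Type*) [NormedAddCommGroup F] [NormedSpace ℝ F]
  (A : M → Type*) [TopologicalSpace (TotalSpace F A)] [∀ x, TopologicalSpace (A x)]
  [FiberBundle F A]

/-- The space `Γ(A)` of smooth sections of the vector bundle `A` (with model fibre `F`). -/
abbrev Sec : Type _ := Cₛ^∞⟮I; F, A⟯

variable [∀ x, AddCommGroup (A x)] [∀ x, Module ℝ (A x)] [VectorBundle ℝ F A]

/-- Multiplication of a section by a function, `(f X)(x) = f(x) X(x)`. -/
instance secSMul : SMul (Fun I M) (Sec I F A) where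
  smul f X := ⟨fun x => f x • X x, ContMDiff.smul_section f.contMDiff X.contMDiff⟩

/-- `Γ(A)` is a module over `C^∞(M)`. -/
instance secModule : Module (Fun I M) (Sec I F A) where
  one_smul X := by ext x; exact one_smul ℝ (X x)
  mul_smul f g X := by ext x; exact mul_smul (f x) (g x) (X x)
  smul_zero f := by ext x; exact smul_zero (f x)
  smul_add f X Y := by ext x; exact smul_add (f x) (X x) (Y x)
  add_smul f g X := by ext x; exact add_smul (f x) (g x) (X x)
  zero_smul X := by ext x; exact zero_smul ℝ (X x)

/-- The `C^∞(M)`-module `Γ(A^*)`, realised as `Hom_{C^∞(M)}(Γ(A), C^∞(M))`. -/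
abbrev DualSec : Type _ := Module.Dual (Fun I M) (Sec I F A)

/-- The `C^∞(M)`-module `Γ(A ⊕ A^*) = Γ(A) × Γ(A^*)`. -/
abbrev DoubleSec : Type _ := Sec I F A × DualSec I F A

end Basic

section Derivative

variable {E : Type*} [NormedAddCommGroup E] [NormedSpace ℝ E]
  {H : Type*} [TopologicalSpace H] {I : ModelWithCorners ℝ E H}
  {M : Type*} [TopologicalSpace M] [ChartedSpace H M] [IsManifold I ∞ M]

theorem contMDiff_mfderiv_apply (f : Fun I M) (V : ∀ x : M, TangentSpace I x)
    (hV : ContMDiff I (I.prod 𝓘(ℝ, E)) ∞ (fun x => TotalSpace.mk' E x (V x))) :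
    ContMDiff I 𝓘(ℝ, ℝ) ∞ (fun x => (mfderiv I 𝓘(ℝ, ℝ) f x (V x) : ℝ)) := by
  have h1 : ContMDiff I.tangent 𝓘(ℝ, ℝ).tangent ∞ (tangentMap I 𝓘(ℝ, ℝ) f) :=
    f.contMDiff.contMDiff_tangentMap (by simp)
  exact (contMDiff_snd_tangentBundle_modelSpace (n := ∞) ℝ 𝓘(ℝ, ℝ)).comp (h1.comp hV)

end Derivative

section Algebroid

variable {E : Type*} [NormedAddCommGroup E] [NormedSpace ℝ E]
  {H : Type*} [TopologicalSpace H] (I : ModelWithCorners ℝ E H)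
  {M : Type*} [TopologicalSpace M] [ChartedSpace H M] [IsManifold I ∞ M]
  (F : Type*) [NormedAddCommGroup F] [NormedSpace ℝ F]
  (A : M → Type*) [TopologicalSpace (TotalSpace F A)] [∀ x, TopologicalSpace (A x)]
  [FiberBundle F A] [∀ x, AddCommGroup (A x)] [∀ x, Module ℝ (A x)] [VectorBundle ℝ F A]
  [∀ x, IsTopologicalAddGroup (A x)] [∀ x, ContinuousSMul ℝ (A x)]

/-- A smooth bundle map `ρ : A → TM` over the identity of `M`. -/
structure AnchorMap where
  toFun : ∀ x : M, A x →L[ℝ] TangentSpace I x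
  contMDiff_toFun : ContMDiff I (I.prod 𝓘(ℝ, F →L[ℝ] E)) ∞
    (fun x => TotalSpace.mk' (F →L[ℝ] E) (E := fun x => A x →L[ℝ] TangentSpace I x) x (toFun x))

variable {I F A}

/-- The derivative `ρ(X) f` of a function `f` along the vector field `ρ(X)`. -/
def AnchorMap.act (ρ : AnchorMap I F A) (X : Sec I F A) (f : Fun I M) : Fun I M :=
  ⟨fun x => (mfderiv I 𝓘(ℝ, ℝ) f x (ρ.toFun x (X x)) : ℝ),
    contMDiff_mfderiv_apply f _ (ρ.contMDiff_toFun.clm_bundle_apply X.contMDiff)⟩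

theorem AnchorMap.act_add (ρ : AnchorMap I F A) (X : Sec I F A) (f g : Fun I M) :
    ρ.act X (f + g) = ρ.act X f + ρ.act X g := by
  ext x
  have hf : MDifferentiableAt I 𝓘(ℝ, ℝ) f x := f.contMDiff.mdifferentiableAt (by simp)
  have hg : MDifferentiableAt I 𝓘(ℝ, ℝ) g x := g.contMDiff.mdifferentiableAt (by simp)
  have h := mfderiv_add hf hg
  exact congrArg (fun T => T (ρ.toFun x (X x))) h

theorem AnchorMap.act_mul (ρ : AnchorMap I F A) (X : Sec I F A) (f g : Fun I M) :
    ρ.act X (f * g) = f * ρ.act X g + g * ρ.act X f := by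
  ext x
  have hf : MDifferentiableAt I 𝓘(ℝ, ℝ) f x := f.contMDiff.mdifferentiableAt (by simp)
  have hg : MDifferentiableAt I 𝓘(ℝ, ℝ) g x := g.contMDiff.mdifferentiableAt (by simp)
  have h := (hf.hasMFDerivAt.mul hg.hasMFDerivAt).mfderiv
  exact congrArg (fun T => T (ρ.toFun x (X x))) h

theorem AnchorMap.act_smul_left (ρ : AnchorMap I F A) (f : Fun I M) (X : Sec I F A)
    (g : Fun I M) : ρ.act (f • X) g = f * ρ.act X g := by
  ext x
  change (mfderiv I 𝓘(ℝ, ℝ) g x (ρ.toFun x (f x • X x)) : ℝ) = f x * _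
  rw [map_smul, map_smul]
  rfl

theorem AnchorMap.act_add_left (ρ : AnchorMap I F A) (X Y : Sec I F A)
    (g : Fun I M) : ρ.act (X + Y) g = ρ.act X g + ρ.act Y g := by
  ext x
  change (mfderiv I 𝓘(ℝ, ℝ) g x (ρ.toFun x (X x + Y x)) : ℝ) = _
  rw [map_add, map_add]
  rfl

variable (I F A)

/-- A Lie algebroid structure `μ` on the vector bundle `A → M`: a real Lie bracket on `Γ(A)` and an
anchor `ρ : A → TM` such that `[X, fY] = f[X, Y] + (ρ(X)f) Y`.
(That `ρ` maps brackets to brackets of vector fields is a consequence.) -/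
structure LieAlgebroid where
  bracket : Sec I F A →ₗ[ℝ] Sec I F A →ₗ[ℝ] Sec I F A
  anchor : AnchorMap I F A
  bracket_self : ∀ X, bracket X X = 0
  jacobi : ∀ X Y Z,
    bracket X (bracket Y Z) + bracket Y (bracket Z X) + bracket Z (bracket X Y) = 0
  leibniz : ∀ (X : Sec I F A) (f : Fun I M) (Y : Sec I F A),
    bracket X (f • Y) = f • bracket X Y + anchor.act X f • Y

/-- A non-degenerate `2`-form on `A`: a smooth section `w` of `∧²A^*`, given as a smooth family of
alternating bilinear forms on the fibres, whose fibre maps `w^♭ : A_x → A_x^*` are injective. -/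
structure NondegTwoForm where
  toFun : ∀ x : M, A x →L[ℝ] A x →L[ℝ] ℝ
  contMDiff_toFun : ContMDiff I (I.prod 𝓘(ℝ, F →L[ℝ] F →L[ℝ] ℝ)) ∞
    (fun x => TotalSpace.mk' (F →L[ℝ] F →L[ℝ] ℝ) (E := fun x => A x →L[ℝ] A x →L[ℝ] ℝ)
      x (toFun x))
  alt : ∀ x v, toFun x v v = 0
  nondeg : ∀ x v, (∀ u, toFun x v u = 0) → v = 0

variable {I F A}

/-- The function `w(X, Y)`. -/
def NondegTwoForm.eval (w : NondegTwoForm I F A) (X Y : Sec I F A) : Fun I M :=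
  ⟨fun x => w.toFun x (X x) (Y x), by
    have h : ContMDiff I (I.prod 𝓘(ℝ, ℝ)) ∞
        (fun x => TotalSpace.mk' ℝ (E := Bundle.Trivial M ℝ) x (w.toFun x (X x) (Y x))) :=
      ContMDiff.clm_bundle_apply₂ (F₁ := F) (F₂ := F) w.contMDiff_toFun X.contMDiff Y.contMDiff
    intro x
    have := h x
    simp only [contMDiffAt_totalSpace] at this
    exact this.2⟩

/-- The map `w^♭ : Γ(A) → Γ(A^*)`, `⟨w^♭ X, Y⟩ = w(X, Y)`. -/
def NondegTwoForm.flat (w : NondegTwoForm I F A) : Sec I F A →ₗ[Fun I M] DualSec I F A :=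
  LinearMap.mk₂ (Fun I M) w.eval
    (fun X Y Z => by
      ext x
      change w.toFun x (X x + Y x) (Z x) = w.toFun x (X x) (Z x) + w.toFun x (Y x) (Z x)
      simp)
    (fun f X Z => by
      ext x
      change w.toFun x (f x • X x) (Z x) = f x * w.toFun x (X x) (Z x)
      simp)
    (fun X Y Z => by
      ext x
      change w.toFun x (X x) (Y x + Z x) = w.toFun x (X x) (Y x) + w.toFun x (X x) (Z x)
      simp)
    (fun f X Z => by
      ext x
      change w.toFun x (X x) (f x • Z x) = f x * w.toFun x (X x) (Z x)
      simp)

/-- The fibre map `π^♯ : A_x^* → A_x` of the inverse bivector `π` of `w`,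
that is, `π^♯ = (w^♭)⁻¹` (an actual inverse by `NondegTwoForm.isInvertible`). -/
def NondegTwoForm.invSharp (w : NondegTwoForm I F A) (x : M) : (A x →L[ℝ] ℝ) →L[ℝ] A x :=
  (w.toFun x).inverse

theorem NondegTwoForm.isInvertible [FiniteDimensional ℝ F] (w : NondegTwoForm I F A) (x : M) :
    (w.toFun x).IsInvertible := by
  let e : A x ≃L[ℝ] F := (trivializationAt F A x).continuousLinearEquivAt ℝ x
    (FiberBundle.mem_baseSet_trivializationAt' x)
  let e' : (A x →L[ℝ] ℝ) ≃L[ℝ] (F →L[ℝ] ℝ) := e.arrowCongr (ContinuousLinearEquiv.refl ℝ ℝ)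
  let T : F →L[ℝ] (F →L[ℝ] ℝ) :=
    (e' : (A x →L[ℝ] ℝ) →L[ℝ] (F →L[ℝ] ℝ)) ∘L w.toFun x ∘L (e.symm : F →L[ℝ] A x)
  have hinj : Function.Injective T := by
    refine (injective_iff_map_eq_zero T).2 fun v hv => ?_
    have h1 : w.toFun x (e.symm v) = 0 := e'.injective (by simpa [T] using hv)
    have h2 : e.symm v = 0 := w.nondeg x _ fun u => by rw [h1]; rfl
    simpa using h2
  have hdim : Module.finrank ℝ F = Module.finrank ℝ (F →L[ℝ] ℝ) := by
    rw [← (LinearMap.toContinuousLinearMap (𝕜 := ℝ) (E := F) (F' := ℝ)).finrank_eq]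
    exact (Subspace.dual_finrank_eq (K := ℝ) (V := F)).symm
  let T' : F ≃L[ℝ] (F →L[ℝ] ℝ) :=
    (LinearEquiv.ofInjectiveOfFinrankEq (T : F →ₗ[ℝ] (F →L[ℝ] ℝ)) hinj hdim).toContinuousLinearEquiv
  refine ⟨(e.trans T').trans e'.symm, ?_⟩
  ext v u
  have h : T' (e v) = e' (w.toFun x v) := by
    change T (e v) = _
    simp [T]
  change e'.symm (T' (e v)) u = _
  rw [h, e'.symm_apply_apply]

/-- `π^♯` maps smooth sections of `A^*` to smooth sections of `A`. -/
theorem NondegTwoForm.contMDiff_invSharp [FiniteDimensional ℝ F] [ContMDiffVectorBundle ∞ F A I]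
    (w : NondegTwoForm I F A)
    (a : ∀ x : M, A x →L[ℝ] ℝ) (ha : ContMDiff I (I.prod 𝓘(ℝ, F →L[ℝ] ℝ)) ∞
      (fun x => TotalSpace.mk' (F →L[ℝ] ℝ) (E := fun x => A x →L[ℝ] ℝ) x (a x))) :
    ContMDiff I (I.prod 𝓘(ℝ, F)) ∞ (fun x => TotalSpace.mk' F x (w.invSharp x (a x))) := by
  intro x₀
  have h0 := w.contMDiff_toFun x₀
  rw [contMDiffAt_hom_bundle] at h0
  have h1 := h0.2
  refine ContMDiffAt.clm_apply_of_inCoordinates (F₁ := F →L[ℝ] ℝ)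
    (E₁ := fun x => A x →L[ℝ] ℝ) (b₁ := id) (b₂ := id) (ϕ := fun x => w.invSharp x)
    (v := a) ?_ (ha x₀) contMDiffAt_id
  have h2 : ContMDiffAt I 𝓘(ℝ, (F →L[ℝ] ℝ) →L[ℝ] F) ∞
      (ContinuousLinearMap.inverse ∘ (fun x : M => ContinuousLinearMap.inCoordinates
        F A (F →L[ℝ] ℝ) (fun x => A x →L[ℝ] ℝ) x₀ x x₀ x (w.toFun x))) x₀ := by
    refine ContMDiffAt.comp x₀ (ContDiffAt.contMDiffAt ?_) h1
    apply ContinuousLinearMap.IsInvertible.contDiffAt_map_inverse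
    rw [ContinuousLinearMap.inCoordinates_eq (FiberBundle.mem_baseSet_trivializationAt' x₀)
      (FiberBundle.mem_baseSet_trivializationAt' x₀)]
    exact ContinuousLinearMap.isInvertible_equiv.comp
      ((w.isInvertible x₀).comp ContinuousLinearMap.isInvertible_equiv)
  refine h2.congr_of_eventuallyEq ?_
  have hA : (trivializationAt F A x₀).baseSet ∈ nhds x₀ :=
    (trivializationAt F A x₀).open_baseSet.mem_nhds (FiberBundle.mem_baseSet_trivializationAt' _)
  have hB : (trivializationAt (F →L[ℝ] ℝ) (fun x => A x →L[ℝ] ℝ) x₀).baseSet ∈ nhds x₀ :=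
    (trivializationAt (F →L[ℝ] ℝ) (fun x => A x →L[ℝ] ℝ) x₀).open_baseSet.mem_nhds
      (FiberBundle.mem_baseSet_trivializationAt' _)
  filter_upwards [hA, hB] with x hx hx'
  simp only [Function.comp_apply, id]
  rw [ContinuousLinearMap.inCoordinates_eq hx' hx, ContinuousLinearMap.inCoordinates_eq hx hx']
  simp only [ContinuousLinearMap.inverse_equiv_comp, ContinuousLinearMap.inverse_comp_equiv,
    ContinuousLinearEquiv.symm_symm]
  rfl

/-- The Lie algebroid differential of a function: `d f ∈ Γ(A^*)`, `(d f)(X) = ρ(X) f`. -/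
def LieAlgebroid.dFun (μ : LieAlgebroid I F A) (f : Fun I M) : DualSec I F A where
  toFun X := μ.anchor.act X f
  map_add' X Y := μ.anchor.act_add_left X Y f
  map_smul' g X := μ.anchor.act_smul_left g X f

/-- The Lie derivative `(L_X α)(Y) = ρ(X)(α(Y)) - α([X, Y])` of `α ∈ Γ(A^*)`. -/
def LieAlgebroid.lieDeriv (μ : LieAlgebroid I F A) (X : Sec I F A) (α : DualSec I F A) :
    DualSec I F A where
  toFun Y := μ.anchor.act X (α Y) - α (μ.bracket X Y)
  map_add' Y Z := by
    rw [map_add, map_add, map_add, μ.anchor.act_add]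
    abel
  map_smul' f Y := by
    rw [μ.leibniz, map_add, map_smul, map_smul, map_smul]
    simp only [smul_eq_mul, RingHom.id_apply]
    rw [μ.anchor.act_mul]
    ring

/-- The Lie algebroid differential of a `2`-form, evaluated on three sections of `A`. -/
def LieAlgebroid.dTwo (μ : LieAlgebroid I F A) (w : NondegTwoForm I F A) (X Y Z : Sec I F A) :
    Fun I M :=
  μ.anchor.act X (w.eval Y Z) - μ.anchor.act Y (w.eval X Z) + μ.anchor.act Z (w.eval X Y)
    - w.eval (μ.bracket X Y) Z + w.eval (μ.bracket X Z) Y - w.eval (μ.bracket Y Z) X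

section Transition

variable [FiniteDimensional ℝ F] [ContMDiffVectorBundle ∞ F A I]

/-- The transition morphisms `N_i = π_{i-1}^♯ ∘ w_{i+1}^♭`, `i ∈ ℤ/3`, as endomorphisms of the
`C^∞(M)`-module `Γ(A)`. -/
def transition (w : ZMod 3 → NondegTwoForm I F A) (i : ZMod 3) :
    Module.End (Fun I M) (Sec I F A) where
  toFun X := ⟨fun x => (w (i - 1)).invSharp x ((w (i + 1)).toFun x (X x)),
    (w (i - 1)).contMDiff_invSharp _
      ((w (i + 1)).contMDiff_toFun.clm_bundle_apply X.contMDiff)⟩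
  map_add' X Y := by
    ext x
    change (w (i - 1)).invSharp x ((w (i + 1)).toFun x (X x + Y x)) = _
    rw [map_add, map_add]
    rfl
  map_smul' f X := by
    ext x
    change (w (i - 1)).invSharp x ((w (i + 1)).toFun x (f x • X x)) = _
    rw [map_smul, map_smul]
    rfl

/-- `(w_1, w_2, w_3)` is an `ε`-hypersymplectic structure with torsion on `(A, μ)`:
`N_i² = ε_i id` for all `i`, and `ε_2 N_1 dw_1 = ε_3 N_2 dw_2 = ε_1 N_3 dw_3`, where
`(N_i dw_i)(X, Y, Z) = dw_i(N_i X, N_i Y, N_i Z)`. The index `3` is `0 : ZMod 3`. -/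
structure IsEpsHypersymplecticWithTorsion (μ : LieAlgebroid I F A) (ε : ZMod 3 → ℝ)
    (w : ZMod 3 → NondegTwoForm I F A) : Prop where
  sign : ∀ i, ε i = 1 ∨ ε i = -1
  sq : ∀ (i : ZMod 3) (X : Sec I F A), transition w i (transition w i X) = ε i • X
  torsion : ∀ (i j : ZMod 3) (X Y Z : Sec I F A),
    ε (i + 1) • μ.dTwo (w i) (transition w i X) (transition w i Y) (transition w i Z) =
      ε (j + 1) • μ.dTwo (w j) (transition w j X) (transition w j Y) (transition w j Z)

/-- Hypersymplectic structures with torsion: `ε_1 = ε_2 = ε_3 = -1`. -/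
def IsHypersymplecticWithTorsion (μ : LieAlgebroid I F A)
    (w : ZMod 3 → NondegTwoForm I F A) : Prop :=
  IsEpsHypersymplecticWithTorsion μ (fun _ => -1) w

/-- Para-hypersymplectic structures with torsion: `ε_1 ε_2 ε_3 = -1`, and not all `ε_i` are `-1`. -/
def IsParaHypersymplecticWithTorsion (μ : LieAlgebroid I F A)
    (w : ZMod 3 → NondegTwoForm I F A) : Prop :=
  ∃ ε : ZMod 3 → ℝ, ε 1 * ε 2 * ε 3 = -1 ∧ ¬ (ε 1 = -1 ∧ ε 2 = -1 ∧ ε 3 = -1) ∧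
    IsEpsHypersymplecticWithTorsion μ ε w

end Transition

variable (I F A)

/-- A cubic function `Θ` of the graded symplectic manifold attached to `A ⊕ A^*`, encoded by the
two operations that determine it: the derived bracket `[e, e']_Θ = {{e, Θ}, e'}` on `Γ(A ⊕ A^*)`,
and the anchor `ρ_Θ(e) f = {{e, Θ}, f}`. -/
@[ext]
structure Cubic where
  bracket : DoubleSec I F A → DoubleSec I F A → DoubleSec I F A
  anchor : DoubleSec I F A → Fun I M → Fun I M

variable {I F A}

instance : Zero (Cubic I F A) := ⟨⟨fun _ _ => 0, fun _ _ => 0⟩⟩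

instance : Add (Cubic I F A) :=
  ⟨fun Θ Θ' => ⟨fun e e' => Θ.bracket e e' + Θ'.bracket e e',
    fun e f => Θ.anchor e f + Θ'.anchor e f⟩⟩

/-- `Θ_J = {J, Θ}` for an endomorphism `J` of `A ⊕ A^*`: the deformed Dorfman bracket
`[e, e']_J = [J e, e'] + [e, J e'] - J [e, e']`, with anchor `ρ ∘ J`. -/
def Cubic.deform (Θ : Cubic I F A) (J : Module.End (Fun I M) (DoubleSec I F A)) : Cubic I F A where
  bracket e e' := Θ.bracket (J e) e' + Θ.bracket e (J e') - J (Θ.bracket e e')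
  anchor e f := Θ.anchor (J e) f

/-- The concomitant `C_Θ(J, K) = Θ_{J,K} + Θ_{K,J}`, where `Θ_{J,K} = (Θ_J)_K`. -/
def Cubic.concomitant (Θ : Cubic I F A) (J K : Module.End (Fun I M) (DoubleSec I F A)) :
    Cubic I F A :=
  (Θ.deform J).deform K + (Θ.deform K).deform J

/-- `μ` as a (pre-)Courant structure on `A ⊕ A^*`, with Dorfman bracket
`[X + α, Y + β] = [X, Y] + L_X β - i_Y dα`, where `i_Y dα = L_Y α - d(α(Y))`, and anchor
`X + α ↦ ρ(X)`. -/
def LieAlgebroid.toCubic (μ : LieAlgebroid I F A) : Cubic I F A where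
  bracket e e' := (μ.bracket e.1 e'.1,
    μ.lieDeriv e.1 e'.2 - (μ.lieDeriv e'.1 e.2 - μ.dFun (e.2 e'.1)))
  anchor e f := μ.anchor.act e.1 f

/-- A `2`-form as the skew-symmetric endomorphism `X + α ↦ 0 + w^♭ X` of `A ⊕ A^*`. -/
def NondegTwoForm.toEnd (w : NondegTwoForm I F A) : Module.End (Fun I M) (DoubleSec I F A) :=
  (LinearMap.inr (Fun I M) (Sec I F A) (DualSec I F A)) ∘ₗ w.flat ∘ₗ
    (LinearMap.fst (Fun I M) (Sec I F A) (DualSec I F A))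

/-- An endomorphism `N` of `A` as the skew-symmetric endomorphism `N ⊕ (-N^*)` of `A ⊕ A^*`. -/
def doubleEnd (N : Module.End (Fun I M) (Sec I F A)) : Module.End (Fun I M) (DoubleSec I F A) :=
  LinearMap.prodMap N (-N.dualMap)

/-- The concomitant `C_μ(w, N) = {N, {w, μ}} + {w, {N, μ}}` of a `2`-form and an endomorphism. -/
def concomitant (μ : LieAlgebroid I F A) (w : NondegTwoForm I F A)
    (N : Module.End (Fun I M) (Sec I F A)) : Cubic I F A :=
  μ.toCubic.concomitant w.toEnd (doubleEnd N)

end Algebroid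

end HST
end HypersymplecticTorsion

/-! Fix `j` and put `N = N_j`, `w = w_{j-1}`, `w' = w_{j+1}`, so that `w' = w ∘ N` and `w' ∘ N = ε_j
w`. The concomitant of a 2-form with `N` has zero anchor, and its bracket is twice `i_N dw - d(w ∘
N)`. The claim therefore amounts to two identities: `i_N dw = dw'` and `i_N dw' = ε_j dw`.

The transition morphisms satisfy quaternion-type relations, and with these the torsion condition
becomes `dw(NX, NY, Z) = -dw'(X, Y, NZ)` (`dTwo_transition`). A general formula
(`evalHom_nijenhuis`) expresses `w(T(X, Y), Z)`, with `T` the Nijenhuis torsion of `N`, through `dw`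
and `dw'`. Under the torsion condition this expression is totally skew in `X, Y, Z`. But `T(NX, Y) =
T(X, NY) = -N T(X, Y)`, and this is compatible with total skewness only if `w(T(X, Y), Z) = 0`. The
vanishing is exactly `i_N dw' = ε_j dw`, and replacing `Z` by `NZ` gives the other identity. -/

namespace HST

/-! ### Real-bilinear calculus of the anchor, the bracket and 2-forms. -/

section Identities

variable {E : Type*} [NormedAddCommGroup E] [NormedSpace ℝ E]
  {H : Type*} [TopologicalSpace H] {I : ModelWithCorners ℝ E H}
  {M : Type*} [TopologicalSpace M] [ChartedSpace H M] [IsManifold I ∞ M]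
  {F : Type*} [NormedAddCommGroup F] [NormedSpace ℝ F]
  {A : M → Type*} [TopologicalSpace (TotalSpace F A)] [∀ x, TopologicalSpace (A x)]
  [FiberBundle F A] [∀ x, AddCommGroup (A x)] [∀ x, Module ℝ (A x)] [VectorBundle ℝ F A]
  [∀ x, IsTopologicalAddGroup (A x)] [∀ x, ContinuousSMul ℝ (A x)]

/-- Real multiples of a section are multiples by constant functions. -/
theorem algebraMap_smul_sec (c : ℝ) (X : Sec I F A) :
    (algebraMap ℝ (Fun I M) c) • X = c • X := rfl

/-- `C^∞(M)`-linear endomorphisms of `Γ(A)` are real-linear. -/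
theorem end_map_real_smul (N : Module.End (Fun I M) (Sec I F A)) (c : ℝ) (X : Sec I F A) :
    N (c • X) = c • N X := by
  rw [← algebraMap_smul_sec, map_smul, algebraMap_smul_sec]

/-- The action of an anchor as a real-bilinear map. -/
noncomputable def AnchorMap.actHom (ρ : AnchorMap I F A) :
    Sec I F A →ₗ[ℝ] Fun I M →ₗ[ℝ] Fun I M :=
  LinearMap.mk₂ ℝ ρ.act ρ.act_add_left
    (fun c X f => by
      rw [← algebraMap_smul_sec, ρ.act_smul_left, Algebra.smul_def])
    ρ.act_add
    (fun c X f => by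
      ext x
      have h := const_smul_mfderiv (s := c)
        (f.contMDiff.mdifferentiableAt (x := x) (by simp))
      exact congrArg (fun T => T (ρ.toFun x (X x))) h)

@[simp]
theorem AnchorMap.actHom_apply (ρ : AnchorMap I F A) (X : Sec I F A) (f : Fun I M) :
    ρ.actHom X f = ρ.act X f := rfl

/-- The evaluation of a `2`-form as a real-bilinear map. -/
noncomputable def NondegTwoForm.evalHom (w : NondegTwoForm I F A) :
    Sec I F A →ₗ[ℝ] Sec I F A →ₗ[ℝ] Fun I M :=
  LinearMap.mk₂ ℝ w.eval
    (fun X Y Z => congrArg (fun T => T Z) (w.flat.map_add X Y))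
    (fun c X Z => by
      have := congrArg (fun T => T Z) (w.flat.map_smul (algebraMap ℝ (Fun I M) c) X)
      rw [Algebra.smul_def]
      exact this)
    (fun X Y Z => (w.flat X).map_add Y Z)
    (fun c X Z => by
      have := (w.flat X).map_smul (algebraMap ℝ (Fun I M) c) Z
      rw [Algebra.smul_def]
      exact this)

theorem NondegTwoForm.evalHom_self (w : NondegTwoForm I F A) (X : Sec I F A) :
    w.evalHom X X = 0 := by
  ext x
  exact w.alt x (X x)

theorem NondegTwoForm.evalHom_swap (w : NondegTwoForm I F A) (X Y : Sec I F A) :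
    w.evalHom X Y = - w.evalHom Y X := by
  have h := w.evalHom_self (X + Y)
  simp only [map_add, LinearMap.add_apply, w.evalHom_self, zero_add, add_zero] at h
  exact eq_neg_of_add_eq_zero_right h

theorem LieAlgebroid.bracket_swap (μ : LieAlgebroid I F A) (X Y : Sec I F A) :
    μ.bracket X Y = - μ.bracket Y X := by
  have h := μ.bracket_self (X + Y)
  simp only [map_add, LinearMap.add_apply, μ.bracket_self, zero_add, add_zero] at h
  exact eq_neg_of_add_eq_zero_right h

theorem LieAlgebroid.dTwo_eq (μ : LieAlgebroid I F A) (w : NondegTwoForm I F A)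
    (X Y Z : Sec I F A) :
    μ.dTwo w X Y Z = μ.anchor.actHom X (w.evalHom Y Z) - μ.anchor.actHom Y (w.evalHom X Z)
      + μ.anchor.actHom Z (w.evalHom X Y) - w.evalHom (μ.bracket X Y) Z
      + w.evalHom (μ.bracket X Z) Y - w.evalHom (μ.bracket Y Z) X := rfl

theorem LieAlgebroid.dTwo_swap_left (μ : LieAlgebroid I F A) (w : NondegTwoForm I F A)
    (X Y Z : Sec I F A) : μ.dTwo w Y X Z = - μ.dTwo w X Y Z := by
  simp only [dTwo_eq]
  rw [w.evalHom_swap Y X, μ.bracket_swap Y X]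
  simp only [map_neg, LinearMap.neg_apply]
  ring

theorem LieAlgebroid.dTwo_swap_right (μ : LieAlgebroid I F A) (w : NondegTwoForm I F A)
    (X Y Z : Sec I F A) : μ.dTwo w X Z Y = - μ.dTwo w X Y Z := by
  simp only [dTwo_eq]
  rw [w.evalHom_swap Z Y, μ.bracket_swap Z Y]
  simp only [map_neg, LinearMap.neg_apply]
  ring

theorem LieAlgebroid.dTwo_smul_left (μ : LieAlgebroid I F A) (w : NondegTwoForm I F A)
    (c : ℝ) (X Y Z : Sec I F A) : μ.dTwo w (c • X) Y Z = c • μ.dTwo w X Y Z := by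
  simp only [dTwo_eq, map_smul, LinearMap.smul_apply]
  module

theorem LieAlgebroid.dTwo_smul_mid (μ : LieAlgebroid I F A) (w : NondegTwoForm I F A)
    (c : ℝ) (X Y Z : Sec I F A) : μ.dTwo w X (c • Y) Z = c • μ.dTwo w X Y Z := by
  simp only [dTwo_eq, map_smul, LinearMap.smul_apply]
  module

theorem LieAlgebroid.dTwo_smul_right (μ : LieAlgebroid I F A) (w : NondegTwoForm I F A)
    (c : ℝ) (X Y Z : Sec I F A) : μ.dTwo w X Y (c • Z) = c • μ.dTwo w X Y Z := by
  simp only [dTwo_eq, map_smul, LinearMap.smul_apply]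
  module

/-! ### Nijenhuis torsion of an endomorphism with scalar square. -/

/-- The Nijenhuis torsion of an endomorphism of `A`. -/
noncomputable def LieAlgebroid.nijenhuis (μ : LieAlgebroid I F A)
    (N : Module.End (Fun I M) (Sec I F A)) (X Y : Sec I F A) : Sec I F A :=
  μ.bracket (N X) (N Y) - N (μ.bracket (N X) Y) - N (μ.bracket X (N Y)) + N (N (μ.bracket X Y))

section SquareScalar

variable (μ : LieAlgebroid I F A) {N : Module.End (Fun I M) (Sec I F A)} {ε : ℝ}
  (hN : ∀ X, N (N X) = ε • X)
include hN

/-- Together with `nijenhuis_map_right`, this lets `N` pass from one argument of the torsion to the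
other; both follow by expanding and replacing each `N²` by the scalar `ε`. -/
theorem LieAlgebroid.nijenhuis_map_left (X Y : Sec I F A) :
    μ.nijenhuis N (N X) Y = - N (μ.nijenhuis N X Y) := by
  simp only [nijenhuis, hN, map_add, map_sub, map_smul, LinearMap.smul_apply, end_map_real_smul]
  module

theorem LieAlgebroid.nijenhuis_map_right (X Y : Sec I F A) :
    μ.nijenhuis N X (N Y) = - N (μ.nijenhuis N X Y) := by
  simp only [nijenhuis, hN, map_add, map_sub, map_smul, end_map_real_smul]
  module

variable {w w' : NondegTwoForm I F A}
  (hw : ∀ X Y, w.evalHom (N X) Y = w'.evalHom X Y)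
include hw

-- Both `w` and `w'` are skew, so `N` may be moved across `w` without a sign.
omit hN in
theorem NondegTwoForm.evalHom_map_right (X Y : Sec I F A) :
    w.evalHom X (N Y) = w'.evalHom X Y := by
  rw [w.evalHom_swap, hw, ← w'.evalHom_swap]

/-- The Nijenhuis torsion in terms of the differentials of `w` and `w ∘ N`. -/
theorem LieAlgebroid.evalHom_nijenhuis (X Y Z : Sec I F A) :
    w.evalHom (μ.nijenhuis N X Y) Z = - μ.dTwo w (N X) (N Y) Z + μ.dTwo w' (N X) Y Z
      + μ.dTwo w' X (N Y) Z - ε • μ.dTwo w X Y Z := by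
  have hr := NondegTwoForm.evalHom_map_right hw
  have hw' : ∀ X Y, w'.evalHom (N X) Y = ε • w.evalHom X Y := fun X Y => by
    rw [← hw, hN, map_smul, LinearMap.smul_apply]
  have hr' : ∀ X Y, w'.evalHom X (N Y) = ε • w.evalHom X Y := fun X Y => by
    rw [w'.evalHom_swap, hw', ← smul_neg, ← w.evalHom_swap]
  simp only [nijenhuis, dTwo_eq, map_add, map_sub, LinearMap.add_apply, LinearMap.sub_apply,
    hw, hr, hw', hr', map_smul]
  module

/-- If `dw(NX, NY, Z) = - d(w ∘ N)(X, Y, NZ)`, then `N` has vanishing torsion. -/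
theorem LieAlgebroid.evalHom_nijenhuis_eq_zero (hε : ε ≠ 0)
    (hd : ∀ X Y Z, μ.dTwo w (N X) (N Y) Z = - μ.dTwo w' X Y (N Z)) (X Y Z : Sec I F A) :
    w.evalHom (μ.nijenhuis N X Y) Z = 0 := by
  have hr := NondegTwoForm.evalHom_map_right hw
  -- After `hd`, the pairing is `i_N dw' - ε dw`, a difference of totally skew expressions.
  have hP : ∀ X Y Z, w.evalHom (μ.nijenhuis N X Y) Z = - w.evalHom (μ.nijenhuis N X Z) Y := by
    intro X Y Z
    simp only [μ.evalHom_nijenhuis hN hw, hd]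
    rw [μ.dTwo_swap_right w' (N X) Y Z, μ.dTwo_swap_right w' X (N Y) Z,
      μ.dTwo_swap_right w' X Y (N Z), μ.dTwo_swap_right w X Y Z]
    module
  have hz : ∀ X Y Z, w.evalHom (μ.nijenhuis N (N X) Y) Z = 0 := by
    intro X Y Z
    have h1 : w.evalHom (μ.nijenhuis N (N X) Y) Z = - w'.evalHom (μ.nijenhuis N X Y) Z := by
      rw [μ.nijenhuis_map_left hN, map_neg, LinearMap.neg_apply, hw]
    -- Swap `Y` and `Z`, carry `N` from `X` to `Z`, and swap back: `N` now acts on the last argument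
    -- of `w`, with the sign opposite to `h1`.
    have h2 : w.evalHom (μ.nijenhuis N (N X) Y) Z = w'.evalHom (μ.nijenhuis N X Y) Z := by
      rw [hP, μ.nijenhuis_map_left hN, ← μ.nijenhuis_map_right hN, ← hP, hr]
    have h3 : (2 : ℝ) • w.evalHom (μ.nijenhuis N (N X) Y) Z = 0 := by
      linear_combination (norm := module) h1 + h2
    exact (smul_eq_zero.1 h3).resolve_left two_ne_zero
  -- A second `N` in the first slot turns `N N X` into `ε X`, and `ε` is invertible.
  have h := hz (N X) Y Z
  rw [hN] at h
  have hs : μ.nijenhuis N (ε • X) Y = ε • μ.nijenhuis N X Y := by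
    simp only [nijenhuis, end_map_real_smul, map_smul, LinearMap.smul_apply]
    module
  rw [hs, map_smul, LinearMap.smul_apply] at h
  exact (smul_eq_zero.1 h).resolve_left hε

/-- If `dw(NX, NY, Z) = - d(w ∘ N)(X, Y, NZ)`, then `i_N d(w ∘ N) = ε dw`. -/
theorem LieAlgebroid.dTwo_contract (hε : ε ≠ 0)
    (hd : ∀ X Y Z, μ.dTwo w (N X) (N Y) Z = - μ.dTwo w' X Y (N Z)) (X Y Z : Sec I F A) :
    μ.dTwo w' (N X) Y Z + μ.dTwo w' X (N Y) Z + μ.dTwo w' X Y (N Z) = ε • μ.dTwo w X Y Z := by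
  have h := μ.evalHom_nijenhuis_eq_zero hN hw hε hd X Y Z
  rw [μ.evalHom_nijenhuis hN hw, hd] at h
  linear_combination (norm := module) h

/-- If `dw(NX, NY, Z) = - d(w ∘ N)(X, Y, NZ)`, then `i_N dw = d(w ∘ N)`. -/
theorem LieAlgebroid.dTwo_contract' (hε : ε ≠ 0)
    (hd : ∀ X Y Z, μ.dTwo w (N X) (N Y) Z = - μ.dTwo w' X Y (N Z)) (X Y Z : Sec I F A) :
    μ.dTwo w (N X) Y Z + μ.dTwo w X (N Y) Z + μ.dTwo w X Y (N Z) = μ.dTwo w' X Y Z := by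
  -- `hl` and `hm` are `hd` with the single `N` in the first and second slot.
  have hl : ∀ X Y Z, μ.dTwo w' (N X) Y Z = - μ.dTwo w X (N Y) (N Z) := by
    intro X Y Z
    rw [μ.dTwo_swap_left w' Y, μ.dTwo_swap_right w' Y, neg_neg]
    have := hd Y Z X
    rw [μ.dTwo_swap_right w (N Y), μ.dTwo_swap_left w X] at this
    linear_combination this
  have hm : ∀ X Y Z, μ.dTwo w' X (N Y) Z = - μ.dTwo w (N X) Y (N Z) := by
    intro X Y Z
    have := hd X Z Y
    rw [μ.dTwo_swap_right w (N X), μ.dTwo_swap_right w' X (N Y)] at this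
    linear_combination -this
  -- With `N Z` as last argument, each term on the left acquires an `N²`, so `ε` factors out of the
  -- whole identity.
  have h := μ.dTwo_contract hN hw hε hd X Y (N Z)
  have hc := hd X Y (N Z)
  simp only [hl, hm, hN, μ.dTwo_smul_right] at h hc
  have h1 : ε • (μ.dTwo w (N X) Y Z + μ.dTwo w X (N Y) Z + μ.dTwo w X Y (N Z)
      - μ.dTwo w' X Y Z) = 0 := by
    linear_combination (norm := module) -h
  exact sub_eq_zero.1 ((smul_eq_zero.1 h1).resolve_left hε)

end SquareScalar

/-! ### The concomitant in terms of differentials. -/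

@[simp]
theorem Cubic.add_bracket (Θ Θ' : Cubic I F A) (e e' : DoubleSec I F A) :
    (Θ + Θ').bracket e e' = Θ.bracket e e' + Θ'.bracket e e' := rfl

@[simp]
theorem Cubic.add_anchor (Θ Θ' : Cubic I F A) (e : DoubleSec I F A) (f : Fun I M) :
    (Θ + Θ').anchor e f = Θ.anchor e f + Θ'.anchor e f := rfl

@[simp]
theorem Cubic.zero_bracket (e e' : DoubleSec I F A) :
    (0 : Cubic I F A).bracket e e' = 0 := rfl

@[simp]
theorem Cubic.zero_anchor (e : DoubleSec I F A) (f : Fun I M) :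
    (0 : Cubic I F A).anchor e f = 0 := rfl

/-- If `w ∘ N = c w'` is a `2`-form, then `C_μ(w, N) = 0` as soon as `i_N dw = d(w ∘ N)`. -/
theorem concomitant_eq_zero (μ : LieAlgebroid I F A) (w w' : NondegTwoForm I F A)
    (N : Module.End (Fun I M) (Sec I F A)) (c : ℝ)
    (hw : ∀ X Y, w.evalHom (N X) Y = c • w'.evalHom X Y)
    (hd : ∀ X Y Z, μ.dTwo w (N X) Y Z + μ.dTwo w X (N Y) Z + μ.dTwo w X Y (N Z)
      = c • μ.dTwo w' X Y Z) :
    concomitant μ w N = 0 := by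
  have hr : ∀ X Y, w.evalHom X (N Y) = c • w'.evalHom X Y := fun X Y => by
    rw [w.evalHom_swap, hw, ← smul_neg, ← w'.evalHom_swap]
  have act0 : ∀ f, μ.anchor.act 0 f = 0 := fun f => by
    rw [← AnchorMap.actHom_apply, map_zero, LinearMap.zero_apply]
  -- The image of `w.toEnd` has zero component in `Γ(A)`, so Lie derivatives and anchors along it
  -- vanish.
  have lie0 : ∀ α, μ.lieDeriv 0 α = 0 := fun α => by
    ext Z : 1
    change μ.anchor.act 0 _ - α (μ.bracket 0 Z) = 0
    simp [act0]
  refine Cubic.ext (funext₂ fun e e' => Prod.ext ?_ (LinearMap.ext fun Z => ?_))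
    (funext₂ fun e f => ?_)
  · simp [concomitant, Cubic.concomitant, Cubic.deform, NondegTwoForm.toEnd, doubleEnd,
      LieAlgebroid.toCubic]
  · simp [concomitant, Cubic.concomitant, Cubic.deform, NondegTwoForm.toEnd, doubleEnd,
      LieAlgebroid.toCubic, lie0]
    have hflat : ∀ X Y, w.flat X Y = w.evalHom X Y := fun _ _ => rfl
    have hlie : ∀ X α Y, μ.lieDeriv X α Y = μ.anchor.actHom X (α Y) - α (μ.bracket X Y) :=
      fun _ _ _ => rfl
    have hdf : ∀ f X, μ.dFun f X = μ.anchor.actHom X f := fun _ _ => rfl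
    have hdual : ∀ X Y, (-N.dualMap (w.flat X)) Y = - w.evalHom X (N Y) := fun _ _ => rfl
    have hs : ∀ (v : NondegTwoForm I F A) (X Y T : Sec I F A),
        v.evalHom X (μ.bracket Y T) = - v.evalHom (μ.bracket Y T) X := fun v X Y T =>
      v.evalHom_swap _ _
    have h := hd e.1 e'.1 Z
    simp only [hflat, hlie, hdf, hdual, LieAlgebroid.dTwo_eq, hw, hr, hs, map_smul, map_neg,
      map_zero] at h ⊢
    -- `(μ_w)_N` contributes `i_N dw` and `(μ_N)_w` contributes `i_N dw - 2 d(w ∘ N)`, whence the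
    -- factor 2.
    linear_combination (norm := module) (2 : ℝ) • h
  · simp [concomitant, Cubic.concomitant, Cubic.deform, NondegTwoForm.toEnd, doubleEnd,
      LieAlgebroid.toCubic, act0]

end Identities

/-! ### Algebra of the transition morphisms. -/

section Transition

variable {E : Type*} [NormedAddCommGroup E] [NormedSpace ℝ E]
  {H : Type*} [TopologicalSpace H] {I : ModelWithCorners ℝ E H}
  {M : Type*} [TopologicalSpace M] [ChartedSpace H M] [IsManifold I ∞ M]
  {F : Type*} [NormedAddCommGroup F] [NormedSpace ℝ F] [FiniteDimensional ℝ F]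
  {A : M → Type*} [TopologicalSpace (TotalSpace F A)] [∀ x, TopologicalSpace (A x)]
  [FiberBundle F A] [∀ x, AddCommGroup (A x)] [∀ x, Module ℝ (A x)] [VectorBundle ℝ F A]
  [∀ x, IsTopologicalAddGroup (A x)] [∀ x, ContinuousSMul ℝ (A x)]
  [ContMDiffVectorBundle ∞ F A I]

theorem NondegTwoForm.toFun_invSharp (w : NondegTwoForm I F A) (x : M) (a : A x →L[ℝ] ℝ) :
    w.toFun x (w.invSharp x a) = a :=
  (w.isInvertible x).self_apply_inverse a

theorem NondegTwoForm.invSharp_toFun (w : NondegTwoForm I F A) (x : M) (v : A x) :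
    w.invSharp x (w.toFun x v) = v :=
  (w.isInvertible x).inverse_apply_self v

theorem evalHom_transition (w : ZMod 3 → NondegTwoForm I F A) (j : ZMod 3) (X Y : Sec I F A) :
    (w (j - 1)).evalHom (transition w j X) Y = (w (j + 1)).evalHom X Y := by
  ext x
  exact congrArg (fun a => a (Y x)) ((w (j - 1)).toFun_invSharp x _)

/-- The composite is `π_{j+1} w_j π_j w_{j-1} π_{j-1} w_{j+1}`, which telescopes. -/
theorem transition_cyclic (w : ZMod 3 → NondegTwoForm I F A) (j : ZMod 3) (X : Sec I F A) :
    transition w (j - 1) (transition w (j + 1) (transition w j X)) = X := by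
  ext x
  change (w (j - 1 - 1)).invSharp x ((w (j - 1 + 1)).toFun x ((w (j + 1 - 1)).invSharp x
    ((w (j + 1 + 1)).toFun x ((w (j - 1)).invSharp x ((w (j + 1)).toFun x (X x)))))) = X x
  have h1 : j - 1 - 1 = j + 1 := by revert j; decide
  have h2 : j - 1 + 1 = j := by ring
  have h3 : j + 1 - 1 = j := by ring
  have h4 : j + 1 + 1 = j - 1 := by revert j; decide
  rw [h1, h2, h3, h4]
  simp only [NondegTwoForm.toFun_invSharp, NondegTwoForm.invSharp_toFun]

/-! ### Consequences of the sign and torsion conditions. -/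

namespace IsEpsHypersymplecticWithTorsion

variable {μ : LieAlgebroid I F A} {ε : ZMod 3 → ℝ} {w : ZMod 3 → NondegTwoForm I F A}

theorem sign_mul_self (h : IsEpsHypersymplecticWithTorsion μ ε w) (i : ZMod 3) :
    ε i * ε i = 1 := by
  rcases h.sign i with hi | hi <;> rw [hi] <;> norm_num

theorem sign_prod (_h : IsEpsHypersymplecticWithTorsion μ ε w) (hε : ε 1 * ε 2 * ε 3 = -1)
    (j : ZMod 3) : ε (j - 1) * ε j * ε (j + 1) = -1 := by
  have h3 : (3 : ZMod 3) = 0 := rfl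
  rw [h3] at hε
  have hj : j = 0 ∨ j = 1 ∨ j = 2 := by clear * -; revert j; decide
  rcases hj with rfl | rfl | rfl
  · rw [show (0 - 1 : ZMod 3) = 2 from rfl, zero_add]
    linear_combination hε
  · rw [show (1 - 1 : ZMod 3) = 0 from rfl, show (1 + 1 : ZMod 3) = 2 from rfl]
    linear_combination hε
  · rw [show (2 - 1 : ZMod 3) = 1 from rfl, show (2 + 1 : ZMod 3) = 0 from rfl]
    linear_combination hε

/-- Apply `N_{j-1}`, which is its own inverse up to `ε_{j-1}`, to the cyclic relation. -/
theorem transition_succ_transition (h : IsEpsHypersymplecticWithTorsion μ ε w) (j : ZMod 3)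
    (X : Sec I F A) :
    transition w (j + 1) (transition w j X) = ε (j - 1) • transition w (j - 1) X := by
  have h1 := congrArg (transition w (j - 1)) (transition_cyclic w j X)
  rw [h.sq] at h1
  rw [← h1, smul_smul, h.sign_mul_self, one_smul]

/-- The reverse product: compared with `transition_succ_transition` at `j - 1`, it says that
`N_{j-1}` and `N_j` anticommute. The minus sign comes from `ε_1 ε_2 ε_3 = -1`, which gives `ε_{j-1}
ε_j = -ε_{j+1}`. -/
theorem transition_pred_transition (h : IsEpsHypersymplecticWithTorsion μ ε w)
    (hε : ε 1 * ε 2 * ε 3 = -1) (j : ZMod 3) (X : Sec I F A) :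
    transition w (j - 1) (transition w j X) = -ε (j + 1) • transition w (j + 1) X := by
  have h1 := h.transition_succ_transition (j + 1) X
  rw [show j + 1 + 1 = j - 1 by clear * -; revert j; decide, add_sub_cancel_right] at h1
  have h2 : transition w j X = ε j • transition w (j - 1) (transition w (j + 1) X) := by
    rw [h1, smul_smul, h.sign_mul_self, one_smul]
  rw [h2, end_map_real_smul, h.sq, smul_smul]
  congr 1
  linear_combination ε (j + 1) * h.sign_prod hε j - ε j * ε (j - 1) * h.sign_mul_self (j + 1)

/-- Evaluating the torsion condition on `N_i X, N_i Y, N_i Z` removes the morphisms on the `i` side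
at the cost of `ε_i³ = ε_i`. -/
theorem dTwo_eq_smul (h : IsEpsHypersymplecticWithTorsion μ ε w) (i j : ZMod 3)
    (X Y Z : Sec I F A) : μ.dTwo (w i) X Y Z = (ε i * ε (i + 1) * ε (j + 1)) •
      μ.dTwo (w j) (transition w j (transition w i X)) (transition w j (transition w i Y))
        (transition w j (transition w i Z)) := by
  have h1 := h.torsion i j (transition w i X) (transition w i Y) (transition w i Z)
  simp only [h.sq i, μ.dTwo_smul_left, μ.dTwo_smul_mid, μ.dTwo_smul_right, smul_smul] at h1
  have h2 := congrArg (fun f => (ε i * ε (i + 1)) • f) h1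
  simp only [smul_smul] at h2
  rw [← h2]
  rw [show ε i * ε (i + 1) * (ε (i + 1) * (ε i * (ε i * ε i))) =
    (ε i * ε i) * (ε i * ε i) * (ε (i + 1) * ε (i + 1)) by ring]
  simp only [h.sign_mul_self, mul_one, one_smul]

/-- Passing from `w_{j-1}` to `w_{j+1}` inserts `N_{j+1} N_{j-1} = -ε_j N_j` in each slot. It
cancels an existing `N_j` up to `-1` and leaves an `N_j` in the third slot. -/
theorem dTwo_transition (h : IsEpsHypersymplecticWithTorsion μ ε w)
    (hε : ε 1 * ε 2 * ε 3 = -1) (j : ZMod 3) (X Y Z : Sec I F A) :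
    μ.dTwo (w (j - 1)) (transition w j X) (transition w j Y) Z =
      - μ.dTwo (w (j + 1)) X Y (transition w j Z) := by
  have h1 : j - 1 - 1 = j + 1 := by clear * -; revert j; decide
  have h2 : j + 1 + 1 = j - 1 := by clear * -; revert j; decide
  have h3 : ∀ Z, transition w (j + 1) (transition w (j - 1) Z) = -ε j • transition w j Z := by
    intro Z
    have := h.transition_pred_transition hε (j - 1) Z
    rwa [h1, sub_add_cancel] at this
  rw [h.dTwo_eq_smul (j - 1) (j + 1), h2, sub_add_cancel]
  simp only [h3, h.sq, μ.dTwo_smul_left, μ.dTwo_smul_mid, μ.dTwo_smul_right, smul_smul]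
  rw [show ε (j - 1) * ε j * ε (j - 1) * (-ε j * ε j * (-ε j * ε j * -ε j)) =
    -((ε j * ε j) * (ε j * ε j) * (ε j * ε j) * (ε (j - 1) * ε (j - 1))) by ring]
  simp only [h.sign_mul_self, mul_one, neg_smul, one_smul]

theorem concomitant_eq_zero (h : IsEpsHypersymplecticWithTorsion μ ε w)
    (hε : ε 1 * ε 2 * ε 3 = -1) {i j : ZMod 3} (hij : i ≠ j) :
    concomitant μ (w i) (transition w j) = 0 := by
  have h0 : ε j ≠ 0 := left_ne_zero_of_mul_eq_one (h.sign_mul_self j)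
  have hw := evalHom_transition w j
  have hd := h.dTwo_transition hε j
  have hi : i = j - 1 ∨ i = j + 1 := by clear * - hij; revert i j; decide
  -- The two indices other than `j` correspond to `w_{j-1} ∘ N_j = w_{j+1}`, with `c = 1`, and
  -- `w_{j+1} ∘ N_j = ε_j w_{j-1}`, with `c = ε_j`.
  rcases hi with rfl | rfl
  · refine HST.concomitant_eq_zero μ _ (w (j + 1)) _ 1 ?_ ?_
    · simpa using hw
    · simpa using μ.dTwo_contract' (h.sq j) hw h0 hd
  · refine HST.concomitant_eq_zero μ _ (w (j - 1)) _ (ε j) (fun X Y => ?_)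
      (μ.dTwo_contract (h.sq j) hw h0 hd)
    rw [← hw, h.sq, map_smul, LinearMap.smul_apply]

end IsEpsHypersymplecticWithTorsion

end Transition

end HST

theorem mainTheorem11
    {E : Type*} [NormedAddCommGroup E] [NormedSpace ℝ E] [FiniteDimensional ℝ E]
    {H : Type*} [TopologicalSpace H] (I : ModelWithCorners ℝ E H)
    {M : Type*} [TopologicalSpace M] [T2Space M] [SigmaCompactSpace M] [ChartedSpace H M]
    [IsManifold I ∞ M] [BoundarylessManifold I M]
    (F : Type*) [NormedAddCommGroup F] [NormedSpace ℝ F] [FiniteDimensional ℝ F]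
    (A : M → Type*) [TopologicalSpace (TotalSpace F A)] [∀ x, TopologicalSpace (A x)]
    [FiberBundle F A] [∀ x, AddCommGroup (A x)] [∀ x, Module ℝ (A x)] [VectorBundle ℝ F A]
    [∀ x, IsTopologicalAddGroup (A x)] [∀ x, ContinuousSMul ℝ (A x)]
    [ContMDiffVectorBundle ∞ F A I]
    (μ : HST.LieAlgebroid I F A) (w : ZMod 3 → HST.NondegTwoForm I F A)
    (h : HST.IsHypersymplecticWithTorsion μ w ∨ HST.IsParaHypersymplecticWithTorsion μ w)
    (i j : ZMod 3) (hij : i ≠ j) :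
    HST.concomitant μ (w i) (HST.transition w j) = 0 := by
  rcases h with h | ⟨ε, hε, -, h⟩
  · exact HST.IsEpsHypersymplecticWithTorsion.concomitant_eq_zero h (by norm_num) hij
  · exact h.concomitant_eq_zero hε hij
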